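/- Work with countably many propositional letters $p_0,p_1,\dots$. Let $\mathcal L$ be the propositional modal language with primitive connectives $\neg,\vee,\Diamond$, and let $\mathcal L_\exists$ be its extension by a second unary modality $\exists$; as usual, $\varphi\to\psi:=\neg\varphi\vee\psi$, $\Box:=\neg\Diamond\neg$ and $\forall:=\neg\exists\neg$. Let $\mathbf{Grz}$ be the Grzegorczyk logic, i.e. the least normal modal logic in $\mathcal L$ containing $p\to\Diamond p$, $\Diamond\Diamond p\to\Diamond p$ and $\Box(\Box(p\to\Box p)\to p)\to p$. Let $\mathbf{MGrz}$ be its least monadic extension, i.e. the least set of $\mathcal L_\exists$-formulas that contains all theorems of $\mathbf{Grz}$, the $\mathbf{S5}$ axioms for $\exists$ and the connecting axiom $\exists\Diamond p\to\Diamond\exists p$, and that is closed under modus ponens, $\Box$-necessitation ($\varphi/\Box\varphi$), $\forall$-necessitation ($\varphi/\forall\varphi$) and uniform substitution. Let $$\mathbf{Grz}_u=\mathbf{MGrz}+\Diamond q\to\exists q$$ be the Grzegorczyk logic enriched with the universal modality, i.e. the least set of $\mathcal L_\exists$-formulas that contains $\mathbf{MGrz}$ and $\Diamond q\to\exists q$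 and is closed under the same rules. An $\mathbf{MK}$-frame is a triple $\mathfrak F=(X,R,E)$ where $X$ is a nonempty set, $R$ is a binary relation on $X$, and $E$ is an equivalence relation on $X$ such that, for all $x,y,z\in X$, if $x\mathrel{E}y$ and $y\mathrel{R}z$, then there is $u\in X$ with $x\mathrel{R}u$ and $u\mathrel{E}z$. Formulas are interpreted in $\mathfrak F$ under a valuation of the letters by subsets of $X$ in the usual way, with $\Diamond$ interpreted by $R$ and $\exists$ by $E$; a formula is valid in $\mathfrak F$ if it is true at every point under every valuation, and it is refuted in $\mathfrak F$ otherwise. $\mathfrak F$ is a $\mathbf{Grz}_u$-frame if every theorem of $\mathbf{Grz}_u$ is valid in $\mathfrak F$. **Corollary.** $\mathbf{Grz}_u$ has the finite model property: every $\mathcal L_\exists$-formula $\varphi\notin\mathbf{Grz}_u$ is refuted in some finite $\mathbf{Grz}_u$-frame. -/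

import Mathlib

/-- Formulas of the propositional modal language with one modality `◇`,
over the propositional letters `p₀, p₁, …`. -/
inductive ModalForm : Type
  | var : ℕ → ModalForm
  | neg : ModalForm → ModalForm
  | or : ModalForm → ModalForm → ModalForm
  | dia : ModalForm → ModalForm

namespace ModalForm

/-- `φ → ψ`, that is `¬φ ∨ ψ`. -/
def imp (φ ψ : ModalForm) : ModalForm := or (neg φ) ψ

/-- `□φ`, that is `¬◇¬φ`. -/
def box (φ : ModalForm) : ModalForm := neg (dia (neg φ))

/-- Uniform substitution of the formula `σ n` for each letter `pₙ`. -/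
def subst (σ : ℕ → ModalForm) : ModalForm → ModalForm
  | var n => σ n
  | neg φ => neg (subst σ φ)
  | or φ ψ => or (subst σ φ) (subst σ ψ)
  | dia φ => dia (subst σ φ)

/-- Classical tautologies: formulas true under every truth assignment that respects `¬` and `∨`
(letters and formulas `◇φ` are treated as atoms). -/
def IsTautology (φ : ModalForm) : Prop :=
  ∀ V : ModalForm → Prop,
    (∀ α, V (neg α) ↔ ¬ V α) → (∀ α β, V (or α β) ↔ (V α ∨ V β)) → V φ

/-- The least set of formulas that contains all classical tautologies, the axioms for the
normal modality `◇` and the formulas of `Γ`, and that is closed under modus ponens,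
`□`-necessitation and uniform substitution: the least normal modal logic containing `Γ`. -/
inductive NormalLogic (Γ : Set ModalForm) : ModalForm → Prop
  | taut {φ : ModalForm} : IsTautology φ → NormalLogic Γ φ
  /-- `□(p → q) → (□p → □q)` -/
  | axK : NormalLogic Γ
      (imp (box (imp (var 0) (var 1))) (imp (box (var 0)) (box (var 1))))
  /-- `◇p → ¬□¬p`; one half of the duality of `◇` and `□` -/
  | dual_left : NormalLogic Γ (imp (dia (var 0)) (neg (box (neg (var 0)))))
  /-- `¬□¬p → ◇p`; the other half -/
  | dual_right : NormalLogic Γ (imp (neg (box (neg (var 0)))) (dia (var 0)))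
  | ax {φ : ModalForm} : φ ∈ Γ → NormalLogic Γ φ
  | mp {φ ψ : ModalForm} : NormalLogic Γ φ → NormalLogic Γ (imp φ ψ) → NormalLogic Γ ψ
  | nec {φ : ModalForm} : NormalLogic Γ φ → NormalLogic Γ (box φ)
  | sub {φ : ModalForm} (σ : ℕ → ModalForm) : NormalLogic Γ φ → NormalLogic Γ (subst σ φ)

end ModalForm

open ModalForm in
/-- The Grzegorczyk logic `Grz`: the least normal modal logic containing the `S4` axioms
`p → ◇p` and `◇◇p → ◇p` and the Grzegorczyk axiom `□(□(p → □p) → p) → p`. -/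
def Grz : Set ModalForm :=
  {φ | NormalLogic
    { imp (var 0) (dia (var 0)),
      imp (dia (dia (var 0))) (dia (var 0)),
      imp (box (imp (box (imp (var 0) (box (var 0)))) (var 0))) (var 0) } φ}

/-- Formulas of the propositional language with the two modalities `◇` and `∃`. -/
inductive MonadicForm : Type
  | var : ℕ → MonadicForm
  | neg : MonadicForm → MonadicForm
  | or : MonadicForm → MonadicForm → MonadicForm
  | dia : MonadicForm → MonadicForm
  | ex : MonadicForm → MonadicForm

/-- Formulas with the single modality `◇` are formulas of the larger language. -/
def ModalForm.toMonadic : ModalForm → MonadicForm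
  | .var n => .var n
  | .neg φ => .neg φ.toMonadic
  | .or φ ψ => .or φ.toMonadic ψ.toMonadic
  | .dia φ => .dia φ.toMonadic

namespace MonadicForm

/-- `φ → ψ`, that is `¬φ ∨ ψ`. -/
def imp (φ ψ : MonadicForm) : MonadicForm := or (neg φ) ψ

/-- `□φ`, that is `¬◇¬φ`. -/
def box (φ : MonadicForm) : MonadicForm := neg (dia (neg φ))

/-- `∀φ`, that is `¬∃¬φ`. -/
def all (φ : MonadicForm) : MonadicForm := neg (ex (neg φ))

/-- Uniform substitution of the formula `σ n` for each letter `pₙ`. -/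
def subst (σ : ℕ → MonadicForm) : MonadicForm → MonadicForm
  | var n => σ n
  | neg φ => neg (subst σ φ)
  | or φ ψ => or (subst σ φ) (subst σ ψ)
  | dia φ => dia (subst σ φ)
  | ex φ => ex (subst σ φ)

/-- The closure of a set `Γ` of formulas under modus ponens, `□`-necessitation,
`∀`-necessitation and uniform substitution. -/
inductive MonadicClosure (Γ : Set MonadicForm) : MonadicForm → Prop
  | ax {φ : MonadicForm} : φ ∈ Γ → MonadicClosure Γ φ
  | mp {φ ψ : MonadicForm} :
      MonadicClosure Γ φ → MonadicClosure Γ (imp φ ψ) → MonadicClosure Γ ψ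
  | nec_box {φ : MonadicForm} : MonadicClosure Γ φ → MonadicClosure Γ (box φ)
  | nec_all {φ : MonadicForm} : MonadicClosure Γ φ → MonadicClosure Γ (all φ)
  | sub {φ : MonadicForm} (σ : ℕ → MonadicForm) :
      MonadicClosure Γ φ → MonadicClosure Γ (subst σ φ)

/-- The `S5` axioms for `∃`: normality (with both halves of the duality of `∃` and `∀`),
`p → ∃p`, `∃∃p → ∃p` and `p → ∀∃p`. -/
def axiomsS5 : Set MonadicForm :=
  { imp (all (imp (var 0) (var 1))) (imp (all (var 0)) (all (var 1))),
    imp (ex (var 0)) (neg (all (neg (var 0)))),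
    imp (neg (all (neg (var 0)))) (ex (var 0)),
    imp (var 0) (ex (var 0)),
    imp (ex (ex (var 0))) (ex (var 0)),
    imp (var 0) (all (ex (var 0))) }

end MonadicForm

open MonadicForm in
/-- The least monadic extension `ML` of a modal logic `L`: generated by the theorems of `L`,
the `S5` axioms for `∃` and the connecting axiom `∃◇p → ◇∃p`. -/
def leastMonadicExtension (L : Set ModalForm) : Set MonadicForm :=
  {φ | MonadicClosure
    (ModalForm.toMonadic '' L ∪ axiomsS5 ∪ {imp (ex (dia (var 0))) (dia (ex (var 0)))}) φ}

/-- `M + α`: the least set of formulas containing the monadic modal logic `M` and the formula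
`α` and closed under the inference rules. -/
def addAxiom (M : Set MonadicForm) (α : MonadicForm) : Set MonadicForm :=
  {φ | MonadicForm.MonadicClosure (M ∪ {α}) φ}

open MonadicForm in
/-- The modal logic `L` enriched with the universal modality: `L_u = ML + ◇q → ∃q`. -/
def enrichUniversal (L : Set ModalForm) : Set MonadicForm :=
  addAxiom (leastMonadicExtension L) (imp (dia (var 1)) (ex (var 1)))

/-- Monadic Kripke frames, or `MK`-frames. -/
structure MKFrame where
  World : Type
  nonempty : Nonempty World
  R : World → World → Prop
  E : World → World → Prop
  equivE : Equivalence E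
  comm : ∀ x y z, E x y → R y z → ∃ u, R x u ∧ E u z

namespace MKFrame

/-- Truth of a formula at a world `x` under a valuation `v`. -/
def Sat (F : MKFrame) (v : ℕ → Set F.World) : F.World → MonadicForm → Prop
  | x, .var n => x ∈ v n
  | x, .neg φ => ¬ F.Sat v x φ
  | x, .or φ ψ => F.Sat v x φ ∨ F.Sat v x ψ
  | x, .dia φ => ∃ y, F.R x y ∧ F.Sat v y φ
  | x, .ex φ => ∃ y, F.E x y ∧ F.Sat v y φ

/-- `φ` is valid in `F`: true at every world under every valuation. -/
def Valid (F : MKFrame) (φ : MonadicForm) : Prop :=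
  ∀ (v : ℕ → Set F.World) (x : F.World), F.Sat v x φ

/-- `F` is an `M`-frame: every theorem of `M` is valid in `F`. -/
def IsFrameOf (F : MKFrame) (M : Set MonadicForm) : Prop :=
  ∀ φ ∈ M, F.Valid φ

end MKFrame

/-- The finite model property of a monadic modal logic `M`:
every non-theorem of `M` is refuted in some finite `M`-frame. -/
def HasFMP (M : Set MonadicForm) : Prop :=
  ∀ φ : MonadicForm, φ ∉ M →
    ∃ F : MKFrame, Finite F.World ∧ F.IsFrameOf M ∧ ¬ F.Valid φ

/-! A non-theorem φ is omitted by some complete theory x. The countermodel has as worlds the traces,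
on a finite set S of formulas, of the complete theories that agree with x on all formulas ∃γ; hence
∃ can be read by the total relation. A trace sees another if the second has strictly fewer formulas
◇γ, or if the two are equal. This is a finite partial order, so the frame validates `Grz`. The
difficulty is to find strict successors: if ◇α is in a trace and α is not, a trace with α and
strictly fewer diamonds is needed. For this S contains `reentry α`, which amounts to ◇(¬α ∧ ◇α). It
belongs to every theory with ◇α but without α, while the Grzegorczyk axiom for ¬α gives a successor
with α and without `reentry α` (`exists_dia`, `reentry_mem`). The truth lemma `sat_traceFrame_iff`
then follows. -/

namespace MonadicForm

/-! ### Complete theories -/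

/-- `Δ` contains `L` and is closed under modus ponens. -/
structure IsTheory (L Δ : Set MonadicForm) : Prop where
  subset : L ⊆ Δ
  mp : ∀ {α β}, α ∈ Δ → imp α β ∈ Δ → β ∈ Δ

/-- The propositional principles from which maximal theories are shown to be
Boolean valuations. -/
structure IsClassical (L : Set MonadicForm) : Prop where
  refl : ∀ α, imp α α ∈ L
  weaken : ∀ α β, imp α (imp β α) ∈ L
  distrib : ∀ α β γ, imp (imp α (imp β γ)) (imp (imp α β) (imp α γ)) ∈ L
  cases : ∀ α β, imp (imp α β) (imp (imp (neg α) β) β) ∈ L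
  explode : ∀ α β, imp α (imp (neg α) β) ∈ L
  or_inl : ∀ α β, imp α (or α β) ∈ L
  or_inr : ∀ α β, imp β (or α β) ∈ L
  or_elim : ∀ α β, imp (or α β) (imp (neg α) β) ∈ L

/-- A theory that decides every formula and respects negation and disjunction. -/
structure IsComplete (L Δ : Set MonadicForm) : Prop extends IsTheory L Δ where
  neg_iff : ∀ α, neg α ∈ Δ ↔ α ∉ Δ
  or_iff : ∀ α β, or α β ∈ Δ ↔ α ∈ Δ ∨ β ∈ Δ

theorem IsComplete.imp_iff {L Δ : Set MonadicForm} (h : IsComplete L Δ) (α β : MonadicForm) :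
    imp α β ∈ Δ ↔ (α ∈ Δ → β ∈ Δ) := by
  rw [imp, h.or_iff, h.neg_iff, imp_iff_not_or]

/-- This plays the role of the deduction theorem: the formulas that β implies modulo Δ are closed
under modus ponens by `distrib`. -/
theorem IsTheory.extend {L Δ : Set MonadicForm} (hL : IsClassical L) (h : IsTheory L Δ)
    (β : MonadicForm) : IsTheory L {γ | imp β γ ∈ Δ} where
  subset γ hγ := h.mp (h.subset hγ) (h.subset (hL.weaken γ β))
  mp {α γ} hα hγ := h.mp hα (h.mp hγ (h.subset (hL.distrib β α γ)))

/-- Lindenbaum's lemma. -/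
theorem IsTheory.exists_isComplete {L Δ : Set MonadicForm} (hL : IsClassical L)
    (h : IsTheory L Δ) {α : MonadicForm} (hα : α ∉ Δ) :
    ∃ M, IsComplete L M ∧ Δ ⊆ M ∧ α ∉ M := by
  obtain ⟨M, hΔM, hM⟩ := zorn_subset_nonempty {T | IsTheory L T ∧ α ∉ T}
    (by
      intro c hc hchain hne
      refine ⟨⋃₀ c, ⟨⟨?_, ?_⟩, ?_⟩, fun s hs => Set.subset_sUnion_of_mem hs⟩
      · obtain ⟨s, hs⟩ := hne
        exact (hc hs).1.subset.trans (Set.subset_sUnion_of_mem hs)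
      · rintro β γ ⟨s, hs, hβ⟩ ⟨t, ht, hγ⟩
        rcases hchain.total hs ht with hst | hst
        · exact ⟨t, ht, (hc ht).1.mp (hst hβ) hγ⟩
        · exact ⟨s, hs, (hc hs).1.mp hβ (hst hγ)⟩
      · rintro ⟨s, hs, hαs⟩
        exact (hc hs).2 hαs)
    Δ ⟨h, hα⟩
  obtain ⟨hT, hαM⟩ := hM.prop
  -- If M does not prove α from β, then extending M by β still omits α, so maximality puts β in M.
  have key : ∀ β, β ∉ M → imp β α ∈ M := by
    intro β hβ
    by_contra hcon
    have hsub : M ⊆ {γ | imp β γ ∈ M} := fun γ hγ => hT.mp hγ (hT.subset (hL.weaken γ β))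
    have hle := hM.le_of_ge (y := {γ | imp β γ ∈ M}) ⟨hT.extend hL β, hcon⟩ hsub
    exact hβ (hle (hT.subset (hL.refl β)))
  have hneg : ∀ β, neg β ∈ M ↔ β ∉ M := by
    refine fun β => ⟨fun hn hβ => ?_, fun hβ => ?_⟩
    · exact hαM (hT.mp hn (hT.mp hβ (hT.subset (hL.explode β α))))
    · by_contra hn
      exact hαM (hT.mp (key _ hn) (hT.mp (key β hβ) (hT.subset (hL.cases β α))))
  refine ⟨M, ⟨hT, hneg, fun β γ => ⟨fun ho => ?_, ?_⟩⟩, hΔM, hαM⟩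
  · by_cases hβ : β ∈ M
    · exact Or.inl hβ
    · exact Or.inr (hT.mp ((hneg β).2 hβ) (hT.mp ho (hT.subset (hL.or_elim β γ))))
  · rintro (hβ | hγ)
    · exact hT.mp hβ (hT.subset (hL.or_inl β γ))
    · exact hT.mp hγ (hT.subset (hL.or_inr β γ))

/-! ### Successor theories for normal operators -/

/-- The dual of the operator `d`. -/
def dual (d : MonadicForm → MonadicForm) (φ : MonadicForm) : MonadicForm := neg (d (neg φ))

/-- The operator `d` is a normal possibility operator of `L`. -/
structure IsNormal (L : Set MonadicForm) (d : MonadicForm → MonadicForm) : Prop where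
  axK : ∀ α β, imp (dual d (imp α β)) (imp (dual d α) (dual d β)) ∈ L
  dual_left : ∀ α, imp (d α) (neg (dual d (neg α))) ∈ L
  dual_right : ∀ α, imp (neg (dual d (neg α))) (d α) ∈ L
  nec : ∀ {α}, α ∈ L → dual d α ∈ L

section Normal

variable {L : Set MonadicForm} {d : MonadicForm → MonadicForm} {x y : Set MonadicForm}

theorem IsNormal.mem_iff (hd : IsNormal L d) (hx : IsComplete L x) (α : MonadicForm) :
    d α ∈ x ↔ dual d (neg α) ∉ x := by
  rw [← hx.neg_iff]
  exact ⟨fun h => hx.mp h (hx.subset (hd.dual_left α)),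
    fun h => hx.mp h (hx.subset (hd.dual_right α))⟩

theorem IsNormal.mem_of_mem (hd : IsNormal L d) (hx : IsComplete L x) (hy : IsComplete L y)
    (hxy : ∀ γ, dual d γ ∈ x → γ ∈ y) {α : MonadicForm} (hα : α ∈ y) : d α ∈ x :=
  (hd.mem_iff hx α).2 fun h => (hy.neg_iff α).1 (hxy _ h) hα

/-- Normality makes the formulas necessary at x a theory; Lindenbaum's lemma extends it while still
omitting α. -/
theorem IsNormal.exists_notMem (hL : IsClassical L) (hd : IsNormal L d) (hx : IsComplete L x)
    {α : MonadicForm} (hα : dual d α ∉ x) :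
    ∃ y, IsComplete L y ∧ (∀ γ, dual d γ ∈ x → γ ∈ y) ∧ α ∉ y := by
  have hT : IsTheory L {γ | dual d γ ∈ x} :=
    ⟨fun γ hγ => hx.subset (hd.nec hγ),
      fun {β γ} hβ hγ => hx.mp hβ (hx.mp hγ (hx.subset (hd.axK β γ)))⟩
  exact hT.exists_isComplete hL hα

theorem IsNormal.exists_mem (hL : IsClassical L) (hd : IsNormal L d) (hx : IsComplete L x)
    {α : MonadicForm} (hα : d α ∈ x) :
    ∃ y, IsComplete L y ∧ (∀ γ, dual d γ ∈ x → γ ∈ y) ∧ α ∈ y := by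
  obtain ⟨y, hy, hxy, hn⟩ := hd.exists_notMem hL hx ((hd.mem_iff hx α).1 hα)
  rw [hy.neg_iff, not_not] at hn
  exact ⟨y, hy, hxy, hn⟩

end Normal

/-! ### Successors under the Grzegorczyk and S5 principles -/

/-- The principles of `Grz` with a universal modality that the completeness proof uses. -/
structure IsGrzUniversal (L : Set MonadicForm) : Prop where
  classical : IsClassical L
  dia_normal : IsNormal L dia
  ex_normal : IsNormal L ex
  dia_refl : ∀ α, imp α (dia α) ∈ L
  dia_trans : ∀ α, imp (dia (dia α)) (dia α) ∈ L
  grz : ∀ α, imp (box (imp (box (imp α (box α))) α)) α ∈ L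
  ex_refl : ∀ α, imp α (ex α) ∈ L
  ex_trans : ∀ α, imp (ex (ex α)) (ex α) ∈ L
  ex_symm : ∀ α, imp α (all (ex α)) ∈ L
  dia_ex : ∀ α, imp (dia α) (ex α) ∈ L

section Successors

variable {L x y : Set MonadicForm}

/-- By S5 the one-sided successor condition already forces agreement on all formulas ∃α: symmetry
turns ∃α at x into ∀∃∃α, which y cannot contradict. -/
theorem IsGrzUniversal.ex_mem_iff (h : IsGrzUniversal L) (hx : IsComplete L x)
    (hy : IsComplete L y) (hxy : ∀ γ ∈ y, ex γ ∈ x) (α : MonadicForm) :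
    ex α ∈ y ↔ ex α ∈ x := by
  refine ⟨fun hα => hx.mp (hxy _ hα) (hx.subset (h.ex_trans α)), fun hα => ?_⟩
  by_contra hn
  have h1 : all (ex (ex α)) ∈ x := hx.mp hα (hx.subset (h.ex_symm (ex α)))
  refine (hx.neg_iff _).1 h1 (hxy _ ((hy.neg_iff _).2 fun h2 => hn ?_))
  exact hy.mp h2 (hy.subset (h.ex_trans α))

theorem IsGrzUniversal.exists_ex (h : IsGrzUniversal L) (hx : IsComplete L x)
    {α : MonadicForm} (hα : ex α ∈ x) :
    ∃ y, IsComplete L y ∧ (∀ γ, ex γ ∈ y ↔ ex γ ∈ x) ∧ α ∈ y := by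
  obtain ⟨y, hy, hxy, hαy⟩ := h.ex_normal.exists_mem h.classical hx hα
  exact ⟨y, hy, h.ex_mem_iff hx hy fun γ hγ => h.ex_normal.mem_of_mem hx hy hxy hγ, hαy⟩

/-- A formula stating that `α` can be left and reached again. -/
def reentry (α : MonadicForm) : MonadicForm := dia (neg (imp (neg α) (box (neg α))))

/-- Every formula that is possible at `x` holds at a successor of `x` from which it cannot
be left and reached again. -/
theorem IsGrzUniversal.exists_dia (h : IsGrzUniversal L) (hx : IsComplete L x)
    {α : MonadicForm} (hα : dia α ∈ x) :
    ∃ y, IsComplete L y ∧ (∀ γ, ex γ ∈ y ↔ ex γ ∈ x) ∧ (∀ γ, dia γ ∈ y → dia γ ∈ x) ∧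
      α ∈ y ∧ reentry α ∉ y := by
  have back : ∀ {u v}, IsComplete L u → IsComplete L v → (∀ γ, dual dia γ ∈ u → γ ∈ v) →
      (∀ γ, ex γ ∈ v ↔ ex γ ∈ u) ∧ ∀ γ, dia γ ∈ v → dia γ ∈ u := by
    intro u v hu hv huv
    refine ⟨h.ex_mem_iff hu hv fun γ hγ => ?_, fun γ hγ => ?_⟩
    · exact hu.mp (h.dia_normal.mem_of_mem hu hv huv hγ) (hu.subset (h.dia_ex γ))
    · exact hu.mp (h.dia_normal.mem_of_mem hu hv huv hγ) (hu.subset (h.dia_trans γ))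
  obtain ⟨z, hz, hxz, hαz⟩ := h.dia_normal.exists_mem h.classical hx hα
  -- The contrapositive of the Grzegorczyk axiom for ¬α, at a successor containing α.
  have hgrz : dual dia (imp (box (imp (neg α) (box (neg α)))) (neg α)) ∉ z := fun hb =>
    (hz.neg_iff α).1 (hz.mp hb (hz.subset (h.grz (neg α)))) hαz
  obtain ⟨y, hy, hzy, hn⟩ := h.dia_normal.exists_notMem h.classical hz hgrz
  rw [hy.imp_iff, Classical.not_imp, hy.neg_iff, not_not] at hn
  obtain ⟨hxz1, hxz2⟩ := back hx hz hxz
  obtain ⟨hzy1, hzy2⟩ := back hz hy hzy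
  -- `hn.1` contains □(¬α → □¬α), which unfolds to the negation of `reentry α`.
  exact ⟨y, hy, fun γ => (hzy1 γ).trans (hxz1 γ), fun γ hγ => hxz2 γ (hzy2 γ hγ), hn.2,
    (hy.neg_iff _).1 hn.1⟩

theorem IsGrzUniversal.reentry_mem (h : IsGrzUniversal L) (hx : IsComplete L x)
    {α : MonadicForm} (hα : dia α ∈ x) (hn : α ∉ x) : reentry α ∈ x := by
  refine hx.mp ?_ (hx.subset (h.dia_refl _))
  rw [hx.neg_iff, hx.imp_iff, Classical.not_imp]
  exact ⟨(hx.neg_iff α).2 hn, (h.dia_normal.mem_iff hx α).1 hα⟩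

end Successors

/-- The subformulas of a formula, together with `reentry α` for each subformula `◇α`. -/
def closure : MonadicForm → Set MonadicForm
  | var n => {var n}
  | neg φ => insert (neg φ) (closure φ)
  | or φ ψ => insert (or φ ψ) (closure φ ∪ closure ψ)
  | dia φ => insert (dia φ) (insert (reentry φ) (closure φ))
  | ex φ => insert (ex φ) (closure φ)

theorem finite_closure (φ : MonadicForm) : (closure φ).Finite := by
  induction φ with
  | var n => exact Set.finite_singleton _
  | neg φ ih => exact ih.insert _
  | or φ ψ ih1 ih2 => exact (ih1.union ih2).insert _
  | dia φ ih => exact (ih.insert _).insert _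
  | ex φ ih => exact ih.insert _

theorem self_mem_closure (φ : MonadicForm) : φ ∈ closure φ := by
  cases φ <;> simp [closure]

end MonadicForm

/-! ### Soundness on finite partial orders -/

namespace MKFrame

open MonadicForm

theorem sat_neg (F : MKFrame) (v : ℕ → Set F.World) (x : F.World) (φ : MonadicForm) :
    F.Sat v x (neg φ) ↔ ¬ F.Sat v x φ := by
  rw [Sat]

theorem sat_or (F : MKFrame) (v : ℕ → Set F.World) (x : F.World) (φ ψ : MonadicForm) :
    F.Sat v x (or φ ψ) ↔ F.Sat v x φ ∨ F.Sat v x ψ := by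
  rw [Sat]

theorem sat_dia (F : MKFrame) (v : ℕ → Set F.World) (x : F.World) (φ : MonadicForm) :
    F.Sat v x (dia φ) ↔ ∃ y, F.R x y ∧ F.Sat v y φ := by
  rw [Sat]

theorem sat_ex (F : MKFrame) (v : ℕ → Set F.World) (x : F.World) (φ : MonadicForm) :
    F.Sat v x (ex φ) ↔ ∃ y, F.E x y ∧ F.Sat v y φ := by
  rw [Sat]

theorem sat_imp (F : MKFrame) (v : ℕ → Set F.World) (x : F.World) (φ ψ : MonadicForm) :
    F.Sat v x (imp φ ψ) ↔ (F.Sat v x φ → F.Sat v x ψ) := by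
  rw [imp, sat_or, sat_neg, imp_iff_not_or]

theorem sat_box (F : MKFrame) (v : ℕ → Set F.World) (x : F.World) (φ : MonadicForm) :
    F.Sat v x (box φ) ↔ ∀ y, F.R x y → F.Sat v y φ := by
  simp [box, sat_neg, sat_dia]

theorem sat_all (F : MKFrame) (v : ℕ → Set F.World) (x : F.World) (φ : MonadicForm) :
    F.Sat v x (all φ) ↔ ∀ y, F.E x y → F.Sat v y φ := by
  simp [all, sat_neg, sat_ex]

theorem sat_subst (F : MKFrame) (v : ℕ → Set F.World) (σ : ℕ → MonadicForm) (φ : MonadicForm)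
    (x : F.World) :
    F.Sat v x (subst σ φ) ↔ F.Sat (fun n => {y | F.Sat v y (σ n)}) x φ := by
  induction φ generalizing x with
  | var n => simp [subst, Sat]
  | neg φ ih => simp [subst, sat_neg, ih]
  | or φ ψ ih1 ih2 => simp [subst, sat_or, ih1, ih2]
  | dia φ ih => simp [subst, sat_dia, ih]
  | ex φ ih => simp [subst, sat_ex, ih]

theorem valid_of_monadicClosure {F : MKFrame} {Γ : Set MonadicForm}
    (hΓ : ∀ φ ∈ Γ, F.Valid φ) {φ : MonadicForm} (h : MonadicClosure Γ φ) : F.Valid φ := by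
  induction h with
  | ax h => exact hΓ _ h
  | mp _ _ ih1 ih2 => exact fun v x => (F.sat_imp v x _ _).1 (ih2 v x) (ih1 v x)
  | nec_box _ ih => exact fun v x => (F.sat_box v x _).2 fun y _ => ih v y
  | nec_all _ ih => exact fun v x => (F.sat_all v x _).2 fun y _ => ih v y
  | sub σ _ ih => exact fun v x => (F.sat_subst v σ _ x).2 (ih _ x)

end MKFrame

namespace ModalForm

theorem toMonadic_subst (σ : ℕ → ModalForm) (φ : ModalForm) :
    (subst σ φ).toMonadic = MonadicForm.subst (fun n => (σ n).toMonadic) φ.toMonadic := by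
  induction φ with
  | var n => rfl
  | neg φ ih => simp [subst, toMonadic, MonadicForm.subst, ih]
  | or φ ψ ih1 ih2 => simp [subst, toMonadic, MonadicForm.subst, ih1, ih2]
  | dia φ ih => simp [subst, toMonadic, MonadicForm.subst, ih]

theorem NormalLogic.valid {F : MKFrame} {Γ : Set ModalForm}
    (hΓ : ∀ φ ∈ Γ, F.Valid φ.toMonadic) {φ : ModalForm} (h : NormalLogic Γ φ) :
    F.Valid φ.toMonadic := by
  induction h with
  | taut h =>
    exact fun v x => h (fun α => F.Sat v x α.toMonadic)
      (fun α => F.sat_neg v x _) (fun α β => F.sat_or v x _ _)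
  | axK =>
    intro v x
    change F.Sat v x (.imp (.box (.imp (.var 0) (.var 1))) (.imp (.box (.var 0)) (.box (.var 1))))
    simp only [MKFrame.sat_imp, MKFrame.sat_box]
    exact fun h1 h2 y hy => h1 y hy (h2 y hy)
  | dual_left =>
    intro v x
    change F.Sat v x (.imp (.dia (.var 0)) (.neg (.box (.neg (.var 0)))))
    simp [MKFrame.sat_imp, MKFrame.sat_box, MKFrame.sat_neg, MKFrame.sat_dia]
  | dual_right =>
    intro v x
    change F.Sat v x (.imp (.neg (.box (.neg (.var 0)))) (.dia (.var 0)))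
    simp [MKFrame.sat_imp, MKFrame.sat_box, MKFrame.sat_neg, MKFrame.sat_dia]
  | ax h => exact hΓ _ h
  | mp _ _ ih1 ih2 => exact fun v x => (F.sat_imp v x _ _).1 (ih2 v x) (ih1 v x)
  | nec _ ih => exact fun v x => (F.sat_box v x _).2 fun y _ => ih v y
  | sub σ _ ih =>
    intro v x
    rw [toMonadic_subst]
    exact (F.sat_subst v _ _ x).2 (ih _ x)

end ModalForm

namespace MKFrame

open MonadicForm

theorem valid_grz_axiom {F : MKFrame} [Finite F.World] (hrefl : ∀ x, F.R x x)
    (htrans : ∀ x y z, F.R x y → F.R y z → F.R x z)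
    (hanti : ∀ x y, F.R x y → F.R y x → x = y) (φ : MonadicForm) :
    F.Valid (imp (box (imp (box (imp φ (box φ))) φ)) φ) := by
  intro v x
  simp only [sat_imp, sat_box]
  intro h
  by_contra hx
  let : PartialOrder F.World :=
    { le := F.R, le_refl := hrefl, le_trans := htrans, le_antisymm := hanti }
  -- Finiteness gives a maximal point y refuting φ. Once φ holds at some z above y, it cannot fail
  -- above z: such a failure would lie below y by maximality and force z = y.
  obtain ⟨y, hxy, hy⟩ :=
    (Set.toFinite {y | ¬ F.Sat v y φ}).exists_le_maximal (a := x) hx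
  refine hy.prop (h y hxy fun z hyz hz w hzw => ?_)
  by_contra hw
  have hwy : w ≤ y := hy.le_of_ge hw (le_trans (α := F.World) hyz hzw)
  have : z = y := le_antisymm (α := F.World) (le_trans (α := F.World) hzw hwy) hyz
  exact hy.prop (this ▸ hz)

theorem isFrameOf_enrichUniversal_Grz {F : MKFrame} [Finite F.World] (hrefl : ∀ x, F.R x x)
    (htrans : ∀ x y z, F.R x y → F.R y z → F.R x z)
    (hanti : ∀ x y, F.R x y → F.R y x → x = y) (hRE : ∀ x y, F.R x y → F.E x y) :
    F.IsFrameOf (enrichUniversal Grz) := by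
  have hsymm : ∀ {x y}, F.E x y → F.E y x := F.equivE.symm
  have hEtrans : ∀ {x y z}, F.E x y → F.E y z → F.E x z := F.equivE.trans
  refine fun φ hφ => valid_of_monadicClosure ?_ hφ
  rintro ψ (hψ | rfl)
  · refine valid_of_monadicClosure ?_ hψ
    rintro χ ((⟨χ, hχ, rfl⟩ | hχ) | rfl)
    · refine ModalForm.NormalLogic.valid ?_ hχ
      rintro α (rfl | rfl | rfl)
      · intro v x
        change F.Sat v x (imp (var 0) (dia (var 0)))
        simp only [sat_imp, sat_dia]
        exact fun h => ⟨x, hrefl x, h⟩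
      · intro v x
        change F.Sat v x (imp (dia (dia (var 0))) (dia (var 0)))
        simp only [sat_imp, sat_dia]
        rintro ⟨y, hy, z, hz, h⟩
        exact ⟨z, htrans _ _ _ hy hz, h⟩
      · exact valid_grz_axiom hrefl htrans hanti (var 0)
    · intro v x
      rcases hχ with rfl | rfl | rfl | rfl | rfl | rfl
      · simp only [sat_imp, sat_all]
        exact fun h1 h2 y hy => h1 y hy (h2 y hy)
      · simp [sat_imp, sat_all, sat_neg, sat_ex]
      · simp [sat_imp, sat_all, sat_neg, sat_ex]
      · simp only [sat_imp, sat_ex]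
        exact fun h => ⟨x, F.equivE.refl x, h⟩
      · simp only [sat_imp, sat_ex]
        rintro ⟨y, hy, z, hz, h⟩
        exact ⟨z, hEtrans hy hz, h⟩
      · simp only [sat_imp, sat_ex, sat_all]
        exact fun h y hy => ⟨x, hsymm hy, h⟩
    · intro v x
      simp only [sat_imp, sat_ex, sat_dia]
      rintro ⟨y, hy, z, hz, h⟩
      obtain ⟨u, hu, huz⟩ := F.comm x y z hy hz
      exact ⟨u, hu, z, huz, h⟩
  · intro v x
    simp only [sat_imp, sat_ex, sat_dia]
    rintro ⟨y, hy, h⟩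
    exact ⟨y, hRE x y hy, h⟩

end MKFrame

/-! ### The required principles as substitution instances -/

theorem mem_enrichUniversal_of_modal {L : Set ModalForm} {φ : ModalForm} (h : φ ∈ L)
    (σ : ℕ → MonadicForm) : MonadicForm.subst σ φ.toMonadic ∈ enrichUniversal L :=
  .sub σ (.ax (.inl (.ax (.inl (.inl ⟨φ, h, rfl⟩)))))

theorem mem_enrichUniversal_of_axiomsS5 {L : Set ModalForm} {φ : MonadicForm}
    (h : φ ∈ MonadicForm.axiomsS5) (σ : ℕ → MonadicForm) :
    MonadicForm.subst σ φ ∈ enrichUniversal L :=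
  .sub σ (.ax (.inl (.ax (.inl (.inr h)))))

/-- The substitution sending `p₀, p₁, p₂` to `α, β, γ`. -/
def substThree (α β γ : MonadicForm) : ℕ → MonadicForm
  | 0 => α
  | 1 => β
  | _ => γ

theorem isClassical_enrichUniversal_Grz : MonadicForm.IsClassical (enrichUniversal Grz) := by
  have inst : ∀ {φ : ModalForm}, φ.IsTautology → ∀ α β γ : MonadicForm,
      MonadicForm.subst (substThree α β γ) φ.toMonadic ∈ enrichUniversal Grz :=
    fun h α β γ => mem_enrichUniversal_of_modal (.taut h) _
  let p : ModalForm := .var 0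
  let q : ModalForm := .var 1
  let r : ModalForm := .var 2
  constructor
  · refine fun α => inst (φ := p.imp p) ?_ α α α
    intro V hn ho
    simp only [ModalForm.imp, hn, ho]; tauto
  · refine fun α β => inst (φ := p.imp (q.imp p)) ?_ α β α
    intro V hn ho
    simp only [ModalForm.imp, hn, ho]; tauto
  · refine fun α β γ =>
      inst (φ := (p.imp (q.imp r)).imp ((p.imp q).imp (p.imp r))) ?_ α β γ
    intro V hn ho
    simp only [ModalForm.imp, hn, ho]; tauto
  · refine fun α β => inst (φ := (p.imp q).imp ((p.neg.imp q).imp q)) ?_ α β α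
    intro V hn ho
    simp only [ModalForm.imp, hn, ho]; tauto
  · refine fun α β => inst (φ := p.imp (p.neg.imp q)) ?_ α β α
    intro V hn ho
    simp only [ModalForm.imp, hn, ho]; tauto
  · refine fun α β => inst (φ := p.imp (p.or q)) ?_ α β α
    intro V hn ho
    simp only [ModalForm.imp, hn, ho]; tauto
  · refine fun α β => inst (φ := q.imp (p.or q)) ?_ α β α
    intro V hn ho
    simp only [ModalForm.imp, hn, ho]; tauto
  · refine fun α β => inst (φ := (p.or q).imp (p.neg.imp q)) ?_ α β α
    intro V hn ho
    simp only [ModalForm.imp, hn, ho]; tauto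

theorem isGrzUniversal_enrichUniversal_Grz :
    MonadicForm.IsGrzUniversal (enrichUniversal Grz) where
  classical := isClassical_enrichUniversal_Grz
  dia_normal :=
    { axK := fun α β => mem_enrichUniversal_of_modal (L := Grz) .axK (substThree α β α)
      dual_left := fun α => mem_enrichUniversal_of_modal (L := Grz) .dual_left (fun _ => α)
      dual_right := fun α => mem_enrichUniversal_of_modal (L := Grz) .dual_right (fun _ => α)
      nec := fun h => .nec_box h }
  ex_normal :=
    { axK := fun α β => mem_enrichUniversal_of_axiomsS5 (.inl rfl) (substThree α β α)
      dual_left := fun α => mem_enrichUniversal_of_axiomsS5 (.inr (.inl rfl)) (fun _ => α)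
      dual_right := fun α =>
        mem_enrichUniversal_of_axiomsS5 (.inr (.inr (.inl rfl))) (fun _ => α)
      nec := fun h => .nec_all h }
  dia_refl α := mem_enrichUniversal_of_modal (L := Grz) (.ax (.inl rfl)) (fun _ => α)
  dia_trans α := mem_enrichUniversal_of_modal (L := Grz) (.ax (.inr (.inl rfl))) (fun _ => α)
  grz α := mem_enrichUniversal_of_modal (L := Grz) (.ax (.inr (.inr rfl))) (fun _ => α)
  ex_refl α := mem_enrichUniversal_of_axiomsS5 (.inr (.inr (.inr (.inl rfl)))) (fun _ => α)
  ex_trans α :=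
    mem_enrichUniversal_of_axiomsS5 (.inr (.inr (.inr (.inr (.inl rfl))))) (fun _ => α)
  ex_symm α :=
    mem_enrichUniversal_of_axiomsS5 (.inr (.inr (.inr (.inr (.inr rfl))))) (fun _ => α)
  dia_ex α := .sub (φ := .imp (.dia (.var 1)) (.ex (.var 1))) (fun _ => α) (.ax (.inr rfl))

/-! ### The finite model of traces -/

namespace MonadicForm

/-- The traces on `S` of the complete theories that contain the same formulas `∃γ` as `x`. -/
def traces (L S x : Set MonadicForm) : Set (Set MonadicForm) :=
  {t | ∃ y, IsComplete L y ∧ (∀ γ, ex γ ∈ y ↔ ex γ ∈ x) ∧ t = y ∩ S}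

/-- `t` sees `t'` if `t'` has fewer formulas `◇γ` than `t`, or the two are equal. -/
def TraceRel (t t' : Set MonadicForm) : Prop :=
  (∀ γ, dia γ ∈ t' → dia γ ∈ t) ∧ ((∀ γ, dia γ ∈ t → dia γ ∈ t') → t = t')

theorem TraceRel.refl (t : Set MonadicForm) : TraceRel t t := ⟨fun _ h => h, fun _ => rfl⟩

theorem TraceRel.trans {t₁ t₂ t₃ : Set MonadicForm} (h : TraceRel t₁ t₂)
    (h' : TraceRel t₂ t₃) : TraceRel t₁ t₃ := by
  refine ⟨fun γ hγ => h.1 γ (h'.1 γ hγ), fun hγ => ?_⟩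
  rw [h.2 fun γ h1 => h'.1 γ (hγ γ h1), h'.2 fun γ h2 => hγ γ (h.1 γ h2)]

theorem TraceRel.antisymm {t t' : Set MonadicForm} (h : TraceRel t t') (h' : TraceRel t' t) :
    t = t' :=
  h.2 h'.1

theorem finite_traces {L S x : Set MonadicForm} (hS : S.Finite) : (traces L S x).Finite :=
  hS.finite_subsets.subset (by rintro t ⟨y, -, -, rfl⟩; exact Set.inter_subset_right)

/-- The frame of traces, with the total relation for `∃`. -/
def traceFrame (L S : Set MonadicForm) {x : Set MonadicForm} (hx : IsComplete L x) : MKFrame where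
  World := traces L S x
  nonempty := ⟨⟨x ∩ S, x, hx, fun _ => Iff.rfl, rfl⟩⟩
  R t t' := TraceRel t.1 t'.1
  E _ _ := True
  equivE := ⟨fun _ => trivial, fun _ => trivial, fun _ _ => trivial⟩
  -- As the relation for ∃ is total, reflexivity of the order suffices.
  comm t _ _ _ _ := ⟨t, TraceRel.refl _, trivial⟩

/-- Only φ and its subformulas are evaluated. The formulas `reentry α` serve as markers in the
traces, so their own subformulas need not lie in S. -/
theorem sat_traceFrame_iff {L S x : Set MonadicForm} (h : IsGrzUniversal L)
    (hx : IsComplete L x) (φ : MonadicForm) (hφ : closure φ ⊆ S)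
    (t : (traceFrame L S hx).World) :
    (traceFrame L S hx).Sat (fun n => {t | var n ∈ t.1}) t φ ↔ φ ∈ t.1 := by
  induction φ generalizing t with
  | var n => rw [MKFrame.Sat]; rfl
  | neg φ ih =>
    rw [MKFrame.sat_neg, ih ((Set.subset_insert _ _).trans hφ)]
    have h1 : neg φ ∈ S := hφ (self_mem_closure _)
    have h2 : φ ∈ S := hφ (.inr (self_mem_closure φ))
    obtain ⟨_, y, hy, -, rfl⟩ := t
    simp [h1, h2, hy.neg_iff]
  | or φ ψ ih1 ih2 =>
    rw [MKFrame.sat_or, ih1 fun _ hc => hφ (.inr (.inl hc)), ih2 fun _ hc => hφ (.inr (.inr hc))]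
    have h1 : or φ ψ ∈ S := hφ (self_mem_closure _)
    have h2 : φ ∈ S := hφ (.inr (.inl (self_mem_closure φ)))
    have h3 : ψ ∈ S := hφ (.inr (.inr (self_mem_closure ψ)))
    obtain ⟨_, y, hy, -, rfl⟩ := t
    simp [h1, h2, h3, hy.or_iff]
  | dia φ ih =>
    have h1 : dia φ ∈ S := hφ (self_mem_closure _)
    have h2 : φ ∈ S := hφ (.inr (.inr (self_mem_closure φ)))
    have h3 : reentry φ ∈ S := hφ (.inr (.inl rfl))
    have ih' := ih fun _ hc => hφ (.inr (.inr hc))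
    rw [MKFrame.sat_dia]
    constructor
    · rintro ⟨t', htt', hs⟩
      have hmem := (ih' t').1 hs
      obtain ⟨z, hz, -, hzt⟩ := t'.2
      rw [hzt] at hmem
      -- φ at t' gives ◇φ at t' by reflexivity, and diamonds pass down the order.
      refine htt'.1 φ ?_
      rw [hzt]
      exact ⟨hz.mp hmem.1 (hz.subset (h.dia_refl φ)), h1⟩
    · intro hmem
      by_cases hm : φ ∈ t.1
      · exact ⟨t, TraceRel.refl _, (ih' t).2 hm⟩
      obtain ⟨_, y, hy, hyx, rfl⟩ := t
      obtain ⟨z, hz, hzy, hdia, hφz, hre⟩ := h.exists_dia hy hmem.1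
      refine ⟨⟨z ∩ S, z, hz, fun γ => (hzy γ).trans (hyx γ), rfl⟩,
        ⟨fun γ hγ => ⟨hdia γ hγ.1, hγ.2⟩, fun hcon => ?_⟩, (ih' _).2 ⟨hφz, h2⟩⟩
      -- `reentry φ` is itself a diamond in S, in y but not in z. So z has strictly fewer diamonds,
      -- and the equality clause of `TraceRel` is vacuous.
      exact absurd (hcon _ ⟨h.reentry_mem hy hmem.1 fun hc => hm ⟨hc, h2⟩, h3⟩).1 hre
  | ex φ ih =>
    have h1 : ex φ ∈ S := hφ (self_mem_closure _)
    have h2 : φ ∈ S := hφ (.inr (self_mem_closure φ))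
    have ih' := ih ((Set.subset_insert _ _).trans hφ)
    rw [MKFrame.sat_ex]
    constructor
    · rintro ⟨t', -, hs⟩
      have hmem := (ih' t').1 hs
      obtain ⟨_, z, hz, hzx, rfl⟩ := t'
      obtain ⟨_, y, hy, hyx, rfl⟩ := t
      exact ⟨(hyx φ).2 ((hzx φ).1 (hz.mp hmem.1 (hz.subset (h.ex_refl φ)))), h1⟩
    · intro hmem
      obtain ⟨_, y, hy, hyx, rfl⟩ := t
      -- The witness agrees with y, hence with x, on all formulas ∃γ, so its trace is a world.
      obtain ⟨z, hz, hzy, hφz⟩ := h.exists_ex hy hmem.1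
      exact ⟨⟨z ∩ S, z, hz, fun γ => (hzy γ).trans (hyx γ), rfl⟩, trivial,
        (ih' _).2 ⟨hφz, h2⟩⟩

end MonadicForm

open MonadicForm in
theorem mainTheorem9 : HasFMP (enrichUniversal Grz) := by
  intro φ hφ
  have h := isGrzUniversal_enrichUniversal_Grz
  obtain ⟨x, hx, -, hφx⟩ := IsTheory.exists_isComplete h.classical
    (⟨subset_rfl, fun hα hβ => .mp hα hβ⟩ : IsTheory (enrichUniversal Grz) _) hφ
  let F := traceFrame (enrichUniversal Grz) (closure φ) hx
  have hfin : Finite F.World := (finite_traces (finite_closure φ)).to_subtype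
  refine ⟨F, hfin, ?_, fun hvalid => ?_⟩
  · exact MKFrame.isFrameOf_enrichUniversal_Grz (fun _ => TraceRel.refl _)
      (fun _ _ _ h1 h2 => h1.trans h2) (fun _ _ h1 h2 => Subtype.ext (h1.antisymm h2))
      (fun _ _ _ => trivial)
  · have hs := hvalid (fun n => {t | var n ∈ t.1}) ⟨x ∩ closure φ, x, hx, fun _ => Iff.rfl, rfl⟩
    exact hφx ((sat_traceFrame_iff h hx φ subset_rfl _).1 hs).1
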